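/- Let $X=\mathbb{R}^d$ with its Euclidean norm, let $\mathcal P_2(X)$ be the set of Borel probability measures on $X$ with finite second moment, $\mathcal P_{2,\mathrm{abs}}(X)$ the subset of those absolutely continuous with respect to Lebesgue measure, and $W_2$ the 2-Wasserstein distance. For $\mu\in\mathcal P_{2,\mathrm{abs}}(X)$ and $\nu\in\mathcal P_2(X)$ let $T_\mu^\nu$ be the ($\mu$-a.e. unique) optimal transport map from $\mu$ to $\nu$ for the cost $\|x-y\|^2$. A function $f:X\to\mathbb R$ has quadratic growth if $|f(x)|\le a(\|x\|^2+1)$ for some $a>0$ and all $x$; write $\mathcal E_f(\mu)=\int_X f\,d\mu$. A functional $\phi:\mathcal P_2(X)\to\mathbb R\cup\{+\infty\}$ is convex along generalized geodesics if $\phi\big((tT_\nu^\mu+(1-t)T_\nu^\pi)_\#\nu\big)\le t\phi(\mu)+(1-t)\phi(\pi)$ for all $\mu,\pi\in\mathcal P_2(X)$, $\nu\in\mathcal P_{2,\mathrm{abs}}(X)$, $t\in[0,1]$. For $\eta>0$ put $$\mathrm{JKO}_{\eta\phi}(\mu)=\operatorname*{arg\,min}_{\nu\in\mathcal P_2(X)}\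 \phi(\nu)+\frac1{2\eta}W_2^2(\mu,\nu).$$ Assume: (i) $\mathcal F=\mathcal E_{G-H}+\mathscr H$ is bounded below on $\mathcal P_2(X)$; (ii) $G,H:X\to\mathbb R$ are convex and have quadratic growth (they may be nonsmooth); (iii) $\mathscr H:\mathcal P_2(X)\to\mathbb R\cup\{+\infty\}$ is proper, lower semicontinuous for $W_2$, convex along generalized geodesics, and $\{\mathscr H<+\infty\}\subset\mathcal P_{2,\mathrm{abs}}(X)$; (iv) $\eta_0>0$ is such that $\mathrm{JKO}_{\eta(\mathcal E_G+\mathscr H)}(\mu)\neq\emptyset$ for all $\eta\in(0,\eta_0)$ and all $\mu\in\mathcal P_2(X)$; (v) $S:X\to X$ is Borel measurable with $S(x)\in\partial H(x)$ (the convex subdifferential) for every $x\in X$. Let $0<\eta<\eta_0$, $\mu_0\in\mathcal P_{2,\mathrm{abs}}(X)$, and let $(\mu_n)_{n\ge0}$ be generated by the semi forward-backward Euler scheme $$\nu_{n+1}=(I+\eta S)_\#\mu_n,\qquad \mu_{n+1}\in\mathrm{JKO}_{\eta(\mathcal E_G+\mathscr H)}(\nu_{n+1}).$$ For $\mu\in\mathcal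 P_{2,\mathrm{abs}}(X)$ define the Wasserstein (sub)gradient mapping $$\mathcal G_\eta(\mu)=\frac1\eta\Big(I-T_\mu^{\,\rho}\Big),\qquad \rho\in\mathrm{JKO}_{\eta(\mathcal E_G+\mathscr H)}\big((I+\eta S)_\#\mu\big).$$ Then, for every $n$, a mapping $\mathcal G_\eta(\mu_n)$ exists and every such mapping belongs to $L^2(X,X,\mu_n)$, and there is a constant $C$, independent of $N$ and of the choices of $\rho$ and of the representatives of the transport maps, such that $$\min_{1\le n\le N}\ \|\mathcal G_\eta(\mu_n)\|^2_{L^2(X,X,\mu_n)}\le \frac CN\qquad\text{for all }N\ge1.$$ -/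

import Mathlib

open MeasureTheory Filter Topology
open scoped ENNReal

noncomputable section

namespace SemiFB

/-- The Euclidean space `ℝᵈ`. -/
abbrev Space (d : ℕ) : Type := EuclideanSpace ℝ (Fin d)

/-- Borel probability measures on `ℝᵈ` with finite second moment. -/
abbrev P2 (d : ℕ) : Type :=
  {μ : Measure (Space d) // IsProbabilityMeasure μ ∧ ∫⁻ x, ‖x‖ₑ ^ 2 ∂μ < ∞}

/-- Absolute continuity with respect to Lebesgue measure. -/
def IsAbs {d : ℕ} (μ : P2 d) : Prop := (μ : Measure (Space d)) ≪ volume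

/-- Transport plans between `μ` and `ν`. -/
def plans {d : ℕ} (μ ν : Measure (Space d)) : Set (Measure (Space d × Space d)) :=
  {γ | γ.map Prod.fst = μ ∧ γ.map Prod.snd = ν}

/-- The 2-Wasserstein distance, with values in `[0, ∞]` (it is finite on `P2`). -/
def W2 {d : ℕ} (μ ν : Measure (Space d)) : ℝ≥0∞ :=
  (⨅ γ ∈ plans μ ν, ∫⁻ p, ‖p.1 - p.2‖ₑ ^ 2 ∂γ) ^ (1 / 2 : ℝ)

/-- `T` is a Borel map that transports `μ` to `ν`. -/
def IsTransportMap {d : ℕ} (μ ν : Measure (Space d)) (T : Space d → Space d) : Prop :=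
  Measurable T ∧ μ.map T = ν

/-- `T` is (a representative of) an optimal map for Monge's problem from `μ` to `ν`
with quadratic cost. -/
def IsOptimalMap {d : ℕ} (μ ν : Measure (Space d)) (T : Space d → Space d) : Prop :=
  IsTransportMap μ ν T ∧
    ∀ T' : Space d → Space d, IsTransportMap μ ν T' →
      ∫⁻ x, ‖x - T x‖ₑ ^ 2 ∂μ ≤ ∫⁻ x, ‖x - T' x‖ₑ ^ 2 ∂μ

/-- Functionals `P2 → ℝ ∪ {+∞}` are `EReal`-valued functions that omit `⊥`; such a functional
is proper if it is not identically `+∞`. -/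
def IsProper {d : ℕ} (φ : P2 d → EReal) : Prop :=
  (∀ μ, φ μ ≠ ⊥) ∧ ∃ μ, φ μ < ⊤

/-- Sequential lower semicontinuity with respect to the Wasserstein distance. -/
def IsLSC {d : ℕ} (φ : P2 d → EReal) : Prop :=
  ∀ (m : ℕ → P2 d) (μ : P2 d),
    Tendsto (fun n => W2 (m n : Measure (Space d)) μ) atTop (𝓝 0) →
      φ μ ≤ liminf (fun n => φ (m n)) atTop

/-- Convexity along generalized geodesics. The measure `ρ` below is the point at time `t` of the
generalized geodesic from `π` to `μ` with base `ν`. -/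
def ConvexAlongGenGeodesics {d : ℕ} (φ : P2 d → EReal) : Prop :=
  ∀ μ π ν : P2 d, IsAbs ν → ∀ T R : Space d → Space d,
    IsOptimalMap (ν : Measure (Space d)) μ T → IsOptimalMap (ν : Measure (Space d)) π R →
      ∀ t : ℝ, 0 ≤ t → t ≤ 1 → ∀ ρ : P2 d,
        (ρ : Measure (Space d)) =
            (ν : Measure (Space d)).map (fun x => t • T x + (1 - t) • R x) →
          φ ρ ≤ (t : EReal) * φ μ + ((1 - t : ℝ) : EReal) * φ π

/-- Quadratic growth. -/
def QuadraticGrowth {d : ℕ} (f : Space d → ℝ) : Prop :=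
  ∃ a : ℝ, 0 < a ∧ ∀ x, |f x| ≤ a * (‖x‖ ^ 2 + 1)

/-- The subdifferential of a convex function. -/
def subdifferential {d : ℕ} (f : Space d → ℝ) (x : Space d) : Set (Space d) :=
  {v | ∀ y, f x + inner ℝ v (y - x) ≤ f y}

/-- The potential energy `μ ↦ ∫ f dμ`. -/
def potential {d : ℕ} (f : Space d → ℝ) (μ : P2 d) : ℝ :=
  ∫ x, f x ∂(μ : Measure (Space d))

/-- The functional `μ ↦ ∫ f dμ + 𝓗 μ`. -/
def energy {d : ℕ} (f : Space d → ℝ) (𝓗 : P2 d → EReal) (μ : P2 d) : EReal :=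
  (potential f μ : EReal) + 𝓗 μ

/-- The set of minimizers over `P2` of `ν ↦ φ ν + W2² (μ, ν) / (2 η)`. -/
def JKO {d : ℕ} (η : ℝ) (φ : P2 d → EReal) (μ : Measure (Space d)) : Set (P2 d) :=
  {ν | ∀ ν' : P2 d,
    φ ν + ((W2 μ ν ^ 2 / ENNReal.ofReal (2 * η) : ℝ≥0∞) : EReal) ≤
      φ ν' + ((W2 μ ν' ^ 2 / ENNReal.ofReal (2 * η) : ℝ≥0∞) : EReal)}

/-- The standing assumptions on `G`, `H`, `𝓗` and the step-size threshold `η₀`. -/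
structure BasicAssumptions {d : ℕ} (G H : Space d → ℝ) (𝓗 : P2 d → EReal) (η₀ : ℝ) : Prop where
  bddBelow : ∃ m : ℝ, ∀ μ : P2 d, (m : EReal) ≤ energy (fun x => G x - H x) 𝓗 μ
  convex_G : ConvexOn ℝ Set.univ G
  growth_G : QuadraticGrowth G
  convex_H : ConvexOn ℝ Set.univ H
  growth_H : QuadraticGrowth H
  proper : IsProper 𝓗
  lsc : IsLSC 𝓗
  convex : ConvexAlongGenGeodesics 𝓗
  dom_abs : ∀ μ : P2 d, 𝓗 μ < ⊤ → IsAbs μ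
  threshold_pos : 0 < η₀
  jko_nonempty : ∀ η : ℝ, 0 < η → η < η₀ → ∀ μ : P2 d,
    (JKO η (energy G 𝓗) (μ : Measure (Space d))).Nonempty

/-- `S` is a selector of the subdifferential of `H`. -/
def IsSubgradientSelector {d : ℕ} (H : Space d → ℝ) (S : Space d → Space d) : Prop :=
  ∀ x, S x ∈ subdifferential H x

/-- The forward step `(I + η S)_# μ`. -/
def forward {d : ℕ} (η : ℝ) (S : Space d → Space d) (μ : P2 d) : Measure (Space d) :=
  (μ : Measure (Space d)).map (fun x => x + η • S x)

/-- `m` is a sequence of iterates of the semi forward-backward Euler scheme, with forward step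
`ν (n + 1) = (I + η S)_# (m n)` and backward step `m (n + 1) ∈ JKO (ν (n + 1))`. -/
def IsSemiFBEuler {d : ℕ} (G : Space d → ℝ) (𝓗 : P2 d → EReal) (S : Space d → Space d) (η : ℝ)
    (m : ℕ → P2 d) : Prop :=
  ∀ n, m (n + 1) ∈ JKO η (energy G 𝓗) (forward η S (m n))

/-- `ξ` is (a representative of) the Wasserstein (sub)gradient mapping
`(I - T) / η` at `μ`, where `T` is the optimal map from `μ` to `JKO ((I + η S)_# μ)`. -/
def IsGradientMapping {d : ℕ} (G : Space d → ℝ) (𝓗 : P2 d → EReal) (S : Space d → Space d)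
    (η : ℝ) (μ : P2 d) (ξ : Space d → Space d) : Prop :=
  ∃ ρ ∈ JKO η (energy G 𝓗) (forward η S μ), ∃ T : Space d → Space d,
    IsOptimalMap (μ : Measure (Space d)) ρ T ∧ ∀ x, ξ x = (1 / η) • (x - T x)

end SemiFB

end

namespace SemiFB

open scoped NNReal

variable {d : ℕ}

/-! The scheme is a descent method for `F = ∫ (G - H) + 𝓗`. Let `ν` be the image of `μ` under `I + η
S` and `ρ` a JKO point of `ν`. Testing minimality of `ρ` against `μ` bounds the objective at `ρ` by
that at `μ`, where `W₂²(ν, μ) ≤ η² ∫ ‖S‖² dμ`. Expanding `‖(x - y) + η S x‖²` along an optimal plan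
from `ν` to `ρ`, pulled back to `μ`, and using the subgradient inequality for `H`, gives `W₂²(ν, ρ)
≥ W₂²(μ, ρ) + 2η (∫ H dμ - ∫ H dρ) + η² ∫ ‖S‖² dμ`. The `‖S‖²` terms cancel, so `F` drops by at
least `W₂²(μ, ρ) / (2η)` (`BasicAssumptions.descent`). Since `F` is bounded below, these drops are
summable, and the smallest of `N` of them is `O(1/N)`.

It remains to identify `‖𝒢_η(μ_n)‖²` with `W₂²(μ_n, μ_{n+1}) / η²` for every choice of `ρ`. As `I +
η S` is expanding, it preserves absolute continuity; generalized geodesics based at `ν` then make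
the JKO point unique (`BasicAssumptions.eq_of_mem_JKO`). Monge and Kantorovich costs agree by
Brenier's theorem, proved here from monotonicity alone: optimal plans have monotone support, and a
monotone relation is single-valued off a Lebesgue null set. -/

/-- The quadratic transport cost of a plan. -/
noncomputable def planCost (γ : Measure (Space d × Space d)) : ℝ≥0∞ :=
  ∫⁻ p, ‖p.1 - p.2‖ₑ ^ 2 ∂γ

/-! ### Plans and finiteness of the Wasserstein cost -/

lemma W2_sq (μ ν : Measure (Space d)) : W2 μ ν ^ 2 = ⨅ γ ∈ plans μ ν, planCost γ := by
  rw [W2, ← ENNReal.rpow_natCast, ← ENNReal.rpow_mul]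
  norm_num [planCost]

lemma W2_sq_le_planCost {μ ν : Measure (Space d)} {γ : Measure (Space d × Space d)}
    (hγ : γ ∈ plans μ ν) : W2 μ ν ^ 2 ≤ planCost γ := by
  rw [W2_sq]
  exact iInf₂_le γ hγ

lemma planCost_map {α : Type*} [MeasurableSpace α] (ν : Measure α) {f g : α → Space d}
    (hf : Measurable f) (hg : Measurable g) :
    planCost (ν.map fun x => (f x, g x)) = ∫⁻ x, ‖f x - g x‖ₑ ^ 2 ∂ν := by
  rw [planCost, lintegral_map (by fun_prop) (by fun_prop)]

lemma map_prodMk_mem_plans {α : Type*} [MeasurableSpace α] (ν : Measure α) {f g : α → Space d}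
    (hf : Measurable f) (hg : Measurable g) :
    (ν.map fun x => (f x, g x)) ∈ plans (ν.map f) (ν.map g) := by
  constructor
  · rw [Measure.map_map measurable_fst (by fun_prop)]; rfl
  · rw [Measure.map_map measurable_snd (by fun_prop)]; rfl

lemma prod_mem_plans (μ ν : Measure (Space d)) [IsProbabilityMeasure μ] [IsProbabilityMeasure ν] :
    μ.prod ν ∈ plans μ ν := by
  constructor <;> simp [Measure.map_fst_prod, Measure.map_snd_prod]

lemma isProbabilityMeasure_of_mem_plans {μ ν : Measure (Space d)} [IsProbabilityMeasure μ]
    {γ : Measure (Space d × Space d)} (hγ : γ ∈ plans μ ν) : IsProbabilityMeasure γ := by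
  constructor
  have h := congrArg (fun m : Measure (Space d) => m Set.univ) hγ.1
  simpa [Measure.map_apply measurable_fst MeasurableSet.univ] using h

lemma enorm_sub_sq_le (x y : Space d) : ‖x - y‖ₑ ^ 2 ≤ 2 * ‖x‖ₑ ^ 2 + 2 * ‖y‖ₑ ^ 2 := by
  have h : ‖x - y‖ ^ 2 ≤ 2 * ‖x‖ ^ 2 + 2 * ‖y‖ ^ 2 := by
    have := norm_sub_le x y
    nlinarith [norm_nonneg (x - y), sq_nonneg (‖x‖ - ‖y‖)]
  simp only [← ofReal_norm]
  rw [← ENNReal.ofReal_pow (norm_nonneg _), ← ENNReal.ofReal_pow (norm_nonneg _),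
    ← ENNReal.ofReal_pow (norm_nonneg _)]
  refine (ENNReal.ofReal_le_ofReal h).trans (le_of_eq ?_)
  rw [ENNReal.ofReal_add (by positivity) (by positivity), ENNReal.ofReal_mul zero_le_two,
    ENNReal.ofReal_mul zero_le_two, ENNReal.ofReal_ofNat]

lemma planCost_lt_top {μ ν : P2 d} {γ : Measure (Space d × Space d)}
    (hγ : γ ∈ plans (μ : Measure (Space d)) ν) : planCost γ < ∞ := by
  have h1 : ∫⁻ p, ‖p.1‖ₑ ^ 2 ∂γ = ∫⁻ x, ‖x‖ₑ ^ 2 ∂(μ : Measure (Space d)) := by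
    rw [← hγ.1, lintegral_map (by fun_prop) (by fun_prop)]
  have h2 : ∫⁻ p, ‖p.2‖ₑ ^ 2 ∂γ = ∫⁻ x, ‖x‖ₑ ^ 2 ∂(ν : Measure (Space d)) := by
    rw [← hγ.2, lintegral_map (by fun_prop) (by fun_prop)]
  calc planCost γ ≤ ∫⁻ p, (2 * ‖p.1‖ₑ ^ 2 + 2 * ‖p.2‖ₑ ^ 2) ∂γ :=
        lintegral_mono fun p => enorm_sub_sq_le _ _
    _ = 2 * ∫⁻ p, ‖p.1‖ₑ ^ 2 ∂γ + 2 * ∫⁻ p, ‖p.2‖ₑ ^ 2 ∂γ := by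
        rw [lintegral_add_left (by fun_prop), lintegral_const_mul _ (by fun_prop),
          lintegral_const_mul _ (by fun_prop)]
    _ < ∞ := by
        rw [h1, h2]
        exact ENNReal.add_lt_top.2 ⟨ENNReal.mul_lt_top (by simp) μ.2.2,
          ENNReal.mul_lt_top (by simp) ν.2.2⟩

lemma W2_sq_lt_top (μ ν : P2 d) : W2 (μ : Measure (Space d)) ν ^ 2 < ∞ := by
  have := μ.2.1
  have := ν.2.1
  exact (W2_sq_le_planCost (prod_mem_plans _ _)).trans_lt (planCost_lt_top (prod_mem_plans _ _))

/-! ### Existence of optimal plans -/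

/-- Truncating the cost gives bounded continuous integrands, whose integrals are weakly continuous;
their supremum is therefore weakly lower semicontinuous. -/
lemma planCost_eq_iSup (γ : Measure (Space d × Space d)) :
    planCost γ = ⨆ k : ℕ, ∫⁻ p, ((min (‖p.1 - p.2‖₊ ^ 2) k : ℝ≥0) : ℝ≥0∞) ∂γ := by
  have hsup := lintegral_iSup (μ := γ)
    (f := fun (k : ℕ) p => ((min (‖p.1 - p.2‖₊ ^ 2) k : ℝ≥0) : ℝ≥0∞)) (fun k => by fun_prop)
    (fun i j hij p => ENNReal.coe_le_coe.2 (min_le_min le_rfl (by exact_mod_cast hij)))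
  rw [← hsup]
  refine lintegral_congr fun p => le_antisymm ?_ (iSup_le fun k => ?_)
  · obtain ⟨k, hk⟩ := exists_nat_ge (‖p.1 - p.2‖₊ ^ 2)
    refine le_iSup_of_le k ?_
    rw [min_eq_left hk]
    simp [enorm]
  · calc ((min (‖p.1 - p.2‖₊ ^ 2) k : ℝ≥0) : ℝ≥0∞) ≤ ((‖p.1 - p.2‖₊ ^ 2 : ℝ≥0) : ℝ≥0∞) :=
          ENNReal.coe_le_coe.2 (min_le_left _ _)
      _ = _ := by simp [enorm]

lemma lowerSemicontinuous_planCost :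
    LowerSemicontinuous fun P : ProbabilityMeasure (Space d × Space d) =>
      planCost (P : Measure (Space d × Space d)) := by
  simp_rw [planCost_eq_iSup]
  refine lowerSemicontinuous_iSup fun k => Continuous.lowerSemicontinuous ?_
  let f : BoundedContinuousFunction (Space d × Space d) ℝ≥0 :=
    BoundedContinuousFunction.mkOfBound
      ⟨fun p => min (‖p.1 - p.2‖₊ ^ 2) k, by fun_prop⟩ k (fun p q => by
        simp only [ContinuousMap.coe_mk, NNReal.dist_eq]
        rw [abs_le]
        have h (p : Space d × Space d) :
            ((min (‖p.1 - p.2‖₊ ^ 2) k : ℝ≥0) : ℝ) ≤ (k : ℝ) := by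
          exact_mod_cast min_le_right _ _
        have h1 := h p
        have h2 := h q
        have h3 := (min (‖p.1 - p.2‖₊ ^ 2) (k : ℝ≥0)).2
        have h4 := (min (‖q.1 - q.2‖₊ ^ 2) (k : ℝ≥0)).2
        constructor <;> linarith)
  exact ProbabilityMeasure.continuous_lintegral_boundedContinuousFunction f

/-- Fixed marginals are tight, which makes the plans tight; Prokhorov's theorem and weak continuity
of the marginals conclude. -/
lemma isCompact_plans (μ ν : ProbabilityMeasure (Space d)) :
    IsCompact {P : ProbabilityMeasure (Space d × Space d) |
      (P : Measure (Space d × Space d)) ∈ plans (μ : Measure (Space d)) ν} := by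
  have hc : IsClosed {P : ProbabilityMeasure (Space d × Space d) |
      (P : Measure (Space d × Space d)) ∈ plans (μ : Measure (Space d)) ν} := by
    have h1 := isClosed_singleton.preimage
      (ProbabilityMeasure.continuous_map (continuous_fst (X := Space d) (Y := Space d)))
      (t := {μ})
    have h2 := isClosed_singleton.preimage
      (ProbabilityMeasure.continuous_map (continuous_snd (X := Space d) (Y := Space d)))
      (t := {ν})
    convert h1.inter h2 using 1
    ext P
    exact ⟨fun h => ⟨Subtype.ext h.1, Subtype.ext h.2⟩,
      fun h => ⟨congrArg Subtype.val h.1, congrArg Subtype.val h.2⟩⟩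
  rw [← hc.closure_eq]
  refine isCompact_closure_of_isTightMeasureSet (IsTightMeasureSet.prodMk ?_ ?_)
  · refine (isTightMeasureSet_singleton (μ := (μ : Measure (Space d)))).subset ?_
    rintro _ ⟨_, ⟨P, hP, rfl⟩, rfl⟩
    exact hP.1
  · refine (isTightMeasureSet_singleton (μ := (ν : Measure (Space d)))).subset ?_
    rintro _ ⟨_, ⟨P, hP, rfl⟩, rfl⟩
    exact hP.2

lemma exists_optimal_plan (μ ν : Measure (Space d)) [IsProbabilityMeasure μ]
    [IsProbabilityMeasure ν] :
    ∃ γ ∈ plans μ ν, ∀ γ' ∈ plans μ ν, planCost γ ≤ planCost γ' := by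
  obtain ⟨P, hP, hmin⟩ := (lowerSemicontinuous_planCost.lowerSemicontinuousOn _).exists_isMinOn
    (⟨⟨μ.prod ν, inferInstance⟩, prod_mem_plans μ ν⟩ : Set.Nonempty
      {P : ProbabilityMeasure (Space d × Space d) |
        (P : Measure (Space d × Space d)) ∈ plans μ ν})
    (isCompact_plans ⟨μ, inferInstance⟩ ⟨ν, inferInstance⟩)
  refine ⟨P, hP, fun γ' hγ' => ?_⟩
  have := isProbabilityMeasure_of_mem_plans hγ'
  exact hmin (show (⟨γ', this⟩ : ProbabilityMeasure (Space d × Space d)) ∈ _ from hγ')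

/-! ### Supports of optimal plans are monotone -/

lemma enorm_swap_lt {x y x' y' : Space d} (h : inner ℝ (x - x') (y - y') < 0) :
    ‖x - y'‖ₑ ^ 2 + ‖x' - y‖ₑ ^ 2 < ‖x - y‖ₑ ^ 2 + ‖x' - y'‖ₑ ^ 2 := by
  have h : ‖x - y'‖ ^ 2 + ‖x' - y‖ ^ 2 < ‖x - y‖ ^ 2 + ‖x' - y'‖ ^ 2 := by
    simp only [inner_sub_left, inner_sub_right] at h
    simp only [norm_sub_sq_real]
    linarith
  simp only [← ofReal_norm]
  simp only [← ENNReal.ofReal_pow (norm_nonneg _)]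
  rw [← ENNReal.ofReal_add (by positivity) (by positivity),
    ← ENNReal.ofReal_add (by positivity) (by positivity)]
  exact (ENNReal.ofReal_lt_ofReal_iff_of_nonneg (by positivity)).2 h

/-- If two support points violated monotonicity, exchanging the second coordinates of a little mass
near each would keep the marginals and strictly lower the finite cost. -/
lemma inner_nonneg_of_mem_support {γ : Measure (Space d × Space d)} [IsFiniteMeasure γ]
    (hfin : planCost γ < ∞)
    (hopt : ∀ γ' ∈ plans (γ.map Prod.fst) (γ.map Prod.snd), planCost γ ≤ planCost γ')
    {p q : Space d × Space d} (hp : p ∈ γ.support) (hq : q ∈ γ.support) :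
    0 ≤ inner ℝ (p.1 - q.1) (p.2 - q.2) := by
  by_contra! hneg
  have hopen : {z : (Space d × Space d) × (Space d × Space d) |
      inner ℝ (z.1.1 - z.2.1) (z.1.2 - z.2.2) < 0} ∈ 𝓝 (p, q) :=
    (isOpen_lt (by fun_prop) (by fun_prop)).mem_nhds hneg
  obtain ⟨U, V, hUo, hpU, hVo, hqV, hUV⟩ := mem_nhds_prod_iff'.1 hopen
  have hU : 0 < γ U := (Measure.mem_support_iff_forall p).1 hp U (hUo.mem_nhds hpU)
  have hV : 0 < γ V := (Measure.mem_support_iff_forall q).1 hq V (hVo.mem_nhds hqV)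
  set π : Measure ((Space d × Space d) × (Space d × Space d)) :=
    (γ.restrict U).prod (γ.restrict V) with hπ
  -- The marginals of `π` are `γ V • γ.restrict U` and `γ U • γ.restrict V`, so this factor keeps
  -- the removed mass below `γ` even if `U` and `V` overlap.
  set ε : ℝ≥0∞ := (γ U + γ V)⁻¹ with hε
  have hs0 : γ U + γ V ≠ 0 := (add_pos_of_pos_of_nonneg hU bot_le).ne'
  have hst : γ U + γ V ≠ ∞ := by simp
  have hεt : ε ≠ ∞ := ENNReal.inv_ne_top.2 hs0
  have hε0 : ε ≠ 0 := ENNReal.inv_ne_zero.2 hst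
  have hfst : π.map Prod.fst = γ V • γ.restrict U := by
    rw [hπ, Measure.map_fst_prod]; simp
  have hsnd : π.map Prod.snd = γ U • γ.restrict V := by
    rw [hπ, Measure.map_snd_prod]; simp
  have hle : ε • (π.map Prod.fst + π.map Prod.snd) ≤ γ := by
    rw [hfst, hsnd]
    calc ε • (γ V • γ.restrict U + γ U • γ.restrict V)
        ≤ ε • (γ V • γ + γ U • γ) := by
          gcongr <;> exact Measure.restrict_le_self
      _ = γ := by
          rw [← add_smul, smul_smul, hε, add_comm (γ V), ENNReal.inv_mul_cancel hs0 hst, one_smul]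
  have hfinε : IsFiniteMeasure (ε • (π.map Prod.fst + π.map Prod.snd)) :=
    isFiniteMeasure_of_le γ hle
  have hrest := Measure.sub_add_cancel_of_le hle
  set rest := γ - ε • (π.map Prod.fst + π.map Prod.snd) with hrest_def
  set γ' : Measure (Space d × Space d) :=
    rest + ε • (π.map (fun z => (z.1.1, z.2.2)) + π.map (fun z => (z.2.1, z.1.2))) with hγ'
  have hmem : γ' ∈ plans (γ.map Prod.fst) (γ.map Prod.snd) := by
    constructor
    · conv_rhs => rw [← hrest]
      simp only [hγ', Measure.map_add _ _ measurable_fst, Measure.map_smul]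
      repeat rw [Measure.map_map (by fun_prop) (by fun_prop)]
      rfl
    · conv_rhs => rw [← hrest]
      simp only [hγ', Measure.map_add _ _ measurable_snd, Measure.map_smul]
      repeat rw [Measure.map_map (by fun_prop) (by fun_prop)]
      rw [add_comm (Measure.map _ π)]
      rfl
  have hcost' : planCost γ' = planCost rest +
      ε * ∫⁻ z, (‖z.1.1 - z.2.2‖ₑ ^ 2 + ‖z.2.1 - z.1.2‖ₑ ^ 2) ∂π := by
    rw [hγ', planCost, lintegral_add_measure, lintegral_smul_measure, lintegral_add_measure,
      lintegral_map (by fun_prop) (by fun_prop), lintegral_map (by fun_prop) (by fun_prop),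
      ← lintegral_add_left (by fun_prop)]
    rfl
  have hcost : planCost γ = planCost rest +
      ε * ∫⁻ z, (‖z.1.1 - z.1.2‖ₑ ^ 2 + ‖z.2.1 - z.2.2‖ₑ ^ 2) ∂π := by
    conv_lhs => rw [← hrest]
    rw [planCost, lintegral_add_measure, lintegral_smul_measure, lintegral_add_measure,
      lintegral_map (by fun_prop) (by fun_prop), lintegral_map (by fun_prop) (by fun_prop),
      ← lintegral_add_left (by fun_prop)]
    rfl
  have hrest_fin : planCost rest ≠ ∞ := by
    rw [hcost] at hfin
    exact (ENNReal.add_lt_top.1 hfin).1.ne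
  have hI_fin : ∫⁻ z, (‖z.1.1 - z.1.2‖ₑ ^ 2 + ‖z.2.1 - z.2.2‖ₑ ^ 2) ∂π ≠ ∞ := by
    intro h
    rw [hcost, h, ENNReal.mul_top hε0] at hfin
    simp at hfin
  have hlt : ∀ᵐ z ∂π, ‖z.1.1 - z.2.2‖ₑ ^ 2 + ‖z.2.1 - z.1.2‖ₑ ^ 2 <
      ‖z.1.1 - z.1.2‖ₑ ^ 2 + ‖z.2.1 - z.2.2‖ₑ ^ 2 := by
    rw [hπ, Measure.prod_restrict]
    filter_upwards [ae_restrict_mem (hUo.measurableSet.prod hVo.measurableSet)] with z hz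
    exact enorm_swap_lt (hUV hz)
  have hπ0 : π ≠ 0 := by
    intro h
    have : π Set.univ = 0 := by rw [h]; rfl
    rw [hπ, Measure.prod_restrict, Measure.restrict_apply_univ, Measure.prod_prod] at this
    exact (mul_ne_zero hU.ne' hV.ne') this
  have hstrict := lintegral_strict_mono hπ0 (by fun_prop)
    ((lintegral_mono_ae (hlt.mono fun _ h => h.le)).trans_lt hI_fin.lt_top).ne hlt
  refine absurd (hopt γ' hmem) (not_le.2 ?_)
  rw [hcost, hcost']
  exact ENNReal.add_lt_add_left hrest_fin ((ENNReal.mul_lt_mul_iff_right hε0 hεt).2 hstrict)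

/-! ### Monotone relations are almost everywhere single-valued -/

/-- Seen from each of its points, `A` misses an open cone around `w`. Each ball about such a point
then contains a ball of a quarter of its radius disjoint from `A`, so no point of `A` is a density
point. -/
lemma volume_eq_zero_of_inner_le {A : Set (Space d)} {w : Space d} (hw : w ≠ 0)
    (hA : ∀ x ∈ A, ∀ z ∈ A, 6 * inner ℝ w (z - x) ≤ ‖w‖ * ‖z - x‖) : volume A = 0 := by
  by_contra h0
  have hae := Besicovitch.ae_tendsto_measure_inter_div (volume : Measure (Space d)) A
  obtain ⟨x, hxA, hx⟩ : ∃ x ∈ A, Tendsto (fun r => volume (A ∩ Metric.closedBall x r) /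
      volume (Metric.closedBall x r)) (𝓝[>] 0) (𝓝 1) := by
    by_contra! hcon
    refine h0 (le_antisymm ?_ bot_le)
    have h1 := Measure.le_restrict_apply (μ := (volume : Measure (Space d))) A A
    rw [Set.inter_self] at h1
    exact h1.trans ((measure_mono fun x hx => hcon x hx).trans (le_of_eq (ae_iff.1 hae)))
  have hw' : 0 < ‖w‖ := norm_pos_iff.2 hw
  set c : ℝ≥0∞ := ENNReal.ofReal ((1 / 4 : ℝ) ^ Module.finrank ℝ (Space d)) with hc
  have hbound : ∀ r : ℝ, 0 < r → c + volume (A ∩ Metric.closedBall x r) /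
      volume (Metric.closedBall x r) ≤ 1 := by
    intro r hr
    have hv0 : volume (Metric.closedBall x r) ≠ 0 := (Metric.measure_closedBall_pos _ _ hr).ne'
    have hvt : volume (Metric.closedBall x r) ≠ ∞ := measure_closedBall_lt_top.ne
    set y : Space d := x + (r / 2 / ‖w‖) • w with hy
    have hyx : ‖y - x‖ = r / 2 := by
      rw [hy, add_sub_cancel_left, norm_smul, Real.norm_of_nonneg (by positivity)]
      field_simp
    have hsub : Metric.closedBall y (r / 4) ⊆ Metric.closedBall x r := by
      refine Metric.closedBall_subset_closedBall' ?_
      rw [dist_eq_norm, hyx]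
      linarith
    have hdisj : Disjoint (Metric.closedBall y (r / 4)) (A ∩ Metric.closedBall x r) := by
      rw [Set.disjoint_left]
      rintro z hz ⟨hzA, -⟩
      rw [mem_closedBall_iff_norm] at hz
      have h1 := hA x hxA z hzA
      have h2 : ‖z - x‖ ≤ 3 * r / 4 := by
        calc ‖z - x‖ = ‖(z - y) + (y - x)‖ := by congr 1; abel
          _ ≤ ‖z - y‖ + ‖y - x‖ := norm_add_le _ _
          _ ≤ 3 * r / 4 := by rw [hyx]; linarith
      have h3 : inner ℝ w (z - x) = inner ℝ w (z - y) + r / 2 * ‖w‖ := by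
        have : z - x = (z - y) + (r / 2 / ‖w‖) • w := by rw [hy]; abel
        rw [this, inner_add_right, inner_smul_right, real_inner_self_eq_norm_sq]
        field_simp
      have h4 : -(‖w‖ * ‖z - y‖) ≤ inner ℝ w (z - y) :=
        (abs_le.1 (abs_real_inner_le_norm w (z - y))).1
      have h5 : ‖w‖ * ‖z - y‖ ≤ ‖w‖ * (r / 4) := by gcongr
      have h6 : ‖w‖ * ‖z - x‖ ≤ ‖w‖ * (3 * r / 4) := by gcongr
      nlinarith [mul_pos hw' hr]
    have hvol : volume (Metric.closedBall y (r / 4)) = c * volume (Metric.closedBall x r) := by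
      rw [Measure.addHaar_closedBall _ _ (by positivity), Measure.addHaar_closedBall _ _ hr.le,
        ← mul_assoc, hc, ← ENNReal.ofReal_mul (by positivity), ← mul_pow]
      congr 3
      ring
    have hsum : c * volume (Metric.closedBall x r) + volume (A ∩ Metric.closedBall x r) ≤
        volume (Metric.closedBall x r) := by
      rw [← hvol, ← measure_union' hdisj Metric.isClosed_closedBall.measurableSet]
      exact measure_mono (Set.union_subset hsub Set.inter_subset_right)
    calc c + volume (A ∩ Metric.closedBall x r) / volume (Metric.closedBall x r)
        = (c * volume (Metric.closedBall x r) + volume (A ∩ Metric.closedBall x r)) /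
          volume (Metric.closedBall x r) := by
          rw [ENNReal.add_div, ENNReal.mul_div_cancel_right hv0 hvt]
      _ ≤ 1 := ENNReal.div_le_of_le_mul (by rwa [one_mul])
  have hlim : c + 1 ≤ 1 := by
    refine le_of_tendsto (hx.const_add c) ?_
    filter_upwards [self_mem_nhdsWithin] with r hr using hbound r hr
  have hc0 : 0 < c := ENNReal.ofReal_pos.2 (by positivity)
  have : (1 : ℝ≥0∞) < c + 1 := by
    rw [add_comm]
    exact ENNReal.lt_add_right (by simp) hc0.ne'
  exact absurd hlim (not_le.2 this)

/-- Two distinct values over `x` are approximated by points of a countable dense set. For a fixed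
pair of approximants, monotonicity becomes the cone condition of `volume_eq_zero_of_inner_le`. -/
lemma volume_multivalued_eq_zero {Γ : Set (Space d × Space d)}
    (hΓ : ∀ p ∈ Γ, ∀ q ∈ Γ, 0 ≤ inner ℝ (p.1 - q.1) (p.2 - q.2)) :
    volume {x : Space d | ∃ y y', (x, y) ∈ Γ ∧ (x, y') ∈ Γ ∧ y ≠ y'} = 0 := by
  let D := TopologicalSpace.denseSeq (Space d)
  let A : ℕ × ℕ → Set (Space d) := fun k => {x | D k.2 - D k.1 ≠ 0 ∧ ∃ y y', (x, y) ∈ Γ ∧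
    (x, y') ∈ Γ ∧ 12 * ‖y - D k.1‖ ≤ ‖D k.2 - D k.1‖ ∧ 12 * ‖y' - D k.2‖ ≤ ‖D k.2 - D k.1‖}
  have hsub : {x : Space d | ∃ y y', (x, y) ∈ Γ ∧ (x, y') ∈ Γ ∧ y ≠ y'} ⊆ ⋃ k, A k := by
    rintro x ⟨y, y', hy, hy', hne⟩
    have hpos : 0 < ‖y' - y‖ := norm_pos_iff.2 (sub_ne_zero.2 hne.symm)
    -- Errors below `‖y' - y‖ / 24` leave the approximants more than `‖y' - y‖ / 2` apart, which is
    -- more than 12 times either error.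
    have hδ : 0 < ‖y' - y‖ / 24 := by positivity
    obtain ⟨i, hi⟩ := (TopologicalSpace.denseRange_denseSeq (Space d)).exists_dist_lt y hδ
    obtain ⟨j, hj⟩ := (TopologicalSpace.denseRange_denseSeq (Space d)).exists_dist_lt y' hδ
    rw [dist_eq_norm] at hi hj
    have htri : ‖y' - y‖ ≤ ‖y' - D j‖ + ‖D j - D i‖ + ‖y - D i‖ := by
      calc ‖y' - y‖ = ‖(y' - D j) + (D j - D i) - (y - D i)‖ := by congr 1; abel
        _ ≤ ‖(y' - D j) + (D j - D i)‖ + ‖y - D i‖ := norm_sub_le _ _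
        _ ≤ _ := by gcongr; exact norm_add_le _ _
    have hij : ‖y' - y‖ / 2 < ‖D j - D i‖ := by
      change ‖y - D i‖ < _ at hi
      change ‖y' - D j‖ < _ at hj
      linarith
    refine Set.mem_iUnion.2 ⟨(i, j), norm_pos_iff.1 (by linarith), y, y', hy, hy', ?_, ?_⟩
    · change 12 * ‖y - D i‖ ≤ ‖D j - D i‖
      change ‖y - D i‖ < _ at hi
      linarith
    · change 12 * ‖y' - D j‖ ≤ ‖D j - D i‖
      change ‖y' - D j‖ < _ at hj
      linarith
  refine measure_mono_null hsub (measure_iUnion_null fun k => ?_)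
  by_cases hk : D k.2 - D k.1 = 0
  · have : A k = ∅ := by
      ext x
      simp [A, hk]
    rw [this, measure_empty]
  refine volume_eq_zero_of_inner_le (w := -(D k.2 - D k.1)) (neg_ne_zero.2 hk) ?_
  -- Monotonicity is applied across the two clusters: the value over `x` near `D k.1` against the
  -- value over `z` near `D k.2`.
  rintro x ⟨-, y, y', hy, hy', hyD, hyD'⟩ z ⟨-, u, u', hu, hu', huD, huD'⟩
  have h1 : 0 ≤ inner ℝ (z - x) (u' - y) := hΓ _ hu' _ hy
  have h2 : u' - y = (D k.2 - D k.1) + ((u' - D k.2) - (y - D k.1)) := by abel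
  rw [h2, inner_add_right] at h1
  have h3 : inner ℝ (z - x) ((u' - D k.2) - (y - D k.1)) ≤
      ‖z - x‖ * ‖(u' - D k.2) - (y - D k.1)‖ := real_inner_le_norm _ _
  have h4 : ‖z - x‖ * ‖(u' - D k.2) - (y - D k.1)‖ ≤ ‖z - x‖ * (‖D k.2 - D k.1‖ / 6) := by
    gcongr
    exact (norm_sub_le _ _).trans (by linarith)
  rw [inner_neg_left, norm_neg, real_inner_comm]
  linarith

/-! ### Brenier's theorem -/

lemma exists_map_of_monotone_plan {γ : Measure (Space d × Space d)} [IsFiniteMeasure γ]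
    (hac : γ.map Prod.fst ≪ volume)
    (hmono : ∀ p ∈ γ.support, ∀ q ∈ γ.support, 0 ≤ inner ℝ (p.1 - q.1) (p.2 - q.2)) :
    ∃ T : Space d → Space d, Measurable T ∧ ∀ᵐ p ∂γ, p.2 = T p.1 := by
  set N := {x : Space d | ∃ y y', (x, y) ∈ γ.support ∧ (x, y') ∈ γ.support ∧ y ≠ y'} with hN
  have hN0 : volume N = 0 := volume_multivalued_eq_zero hmono
  set M := toMeasurable volume N with hM
  have hM0 : volume M = 0 := by rw [hM, measure_toMeasurable, hN0]
  set Γ : Set (Space d × Space d) := γ.support ∩ Prod.fst ⁻¹' Mᶜ with hΓ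
  have hΓm : MeasurableSet Γ := Measure.isClosed_support.measurableSet.inter
    (measurable_fst (measurableSet_toMeasurable _ _).compl)
  have hΓae : ∀ᵐ p ∂γ, p ∈ Γ := by
    have h1 : ∀ᵐ p ∂γ, p.1 ∈ Mᶜ := by
      refine ae_of_ae_map (p := fun x => x ∈ Mᶜ) measurable_fst.aemeasurable (hac.ae_le ?_)
      exact compl_mem_ae_iff.2 hM0
    filter_upwards [h1, Measure.support_mem_ae (μ := γ)] with p hp hp' using ⟨hp', hp⟩
  have : StandardBorelSpace Γ := hΓm.standardBorel
  -- An injective Borel map on a standard Borel space is an embedding (Lusin–Souslin), so the graph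
  -- `Γ` is that of a Borel function.
  have hemb : MeasurableEmbedding (fun p : Γ => p.1.1) := by
    refine Measurable.measurableEmbedding (by fun_prop) ?_
    rintro ⟨⟨x, y⟩, hp, hpM⟩ ⟨⟨x', y'⟩, hq, hqM⟩ hxx
    obtain rfl : x = x' := hxx
    obtain rfl : y = y' := by
      by_contra hne
      exact hpM (subset_toMeasurable _ _ ⟨y, y', hp, hq, hne⟩)
    rfl
  obtain ⟨T, hT, hcomp⟩ := hemb.exists_measurable_extend
    (g := fun p : Γ => p.1.2) (by fun_prop) (fun _ => inferInstance)
  refine ⟨T, hT, ?_⟩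
  filter_upwards [hΓae] with p hp
  exact (congrFun hcomp ⟨p, hp⟩).symm

/-- **Brenier's theorem**: from an absolutely continuous measure there is an optimal map, and it is
optimal among all transport plans. -/
theorem exists_transportMap_lintegral_eq_W2_sq (μ ν : P2 d) (hμ : IsAbs μ) :
    ∃ T, IsTransportMap (μ : Measure (Space d)) ν T ∧
      ∫⁻ x, ‖x - T x‖ₑ ^ 2 ∂(μ : Measure (Space d)) = W2 (μ : Measure (Space d)) ν ^ 2 := by
  have := μ.2.1
  have := ν.2.1
  obtain ⟨γ, hγ, hopt⟩ := exists_optimal_plan (μ : Measure (Space d)) ν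
  have := isProbabilityMeasure_of_mem_plans hγ
  obtain ⟨T, hT, hTγ⟩ := exists_map_of_monotone_plan (γ := γ) (by rw [hγ.1]; exact hμ)
    (fun p hp q hq => inner_nonneg_of_mem_support (planCost_lt_top hγ)
      (by rw [hγ.1, hγ.2]; exact hopt) hp hq)
  refine ⟨T, ⟨hT, ?_⟩, ?_⟩
  · rw [← hγ.1, Measure.map_map hT measurable_fst, ← hγ.2]
    exact Measure.map_congr (hTγ.mono fun p hp => hp.symm)
  · rw [W2_sq]
    refine le_antisymm (le_iInf₂ fun γ' hγ' => le_trans (le_of_eq ?_) (hopt γ' hγ'))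
      ((iInf₂_le γ hγ).trans (le_of_eq ?_))
    all_goals
      rw [← hγ.1, lintegral_map (by fun_prop) measurable_fst, planCost]
      refine lintegral_congr_ae (hTγ.mono fun p hp => ?_)
      simp only [hp]

lemma W2_sq_le_of_isTransportMap {μ ν : Measure (Space d)} {T : Space d → Space d}
    (hT : IsTransportMap μ ν T) : W2 μ ν ^ 2 ≤ ∫⁻ x, ‖x - T x‖ₑ ^ 2 ∂μ := by
  have h := map_prodMk_mem_plans μ measurable_id hT.1
  rw [Measure.map_id, hT.2] at h
  refine (W2_sq_le_planCost h).trans (le_of_eq ?_)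
  exact planCost_map μ measurable_id hT.1

theorem exists_isOptimalMap (μ ν : P2 d) (hμ : IsAbs μ) :
    ∃ T, IsOptimalMap (μ : Measure (Space d)) ν T := by
  obtain ⟨T, hT, hcost⟩ := exists_transportMap_lintegral_eq_W2_sq μ ν hμ
  exact ⟨T, hT, fun T' hT' => hcost.le.trans (W2_sq_le_of_isTransportMap hT')⟩

theorem IsOptimalMap.lintegral_eq {μ ν : P2 d} (hμ : IsAbs μ) {T : Space d → Space d}
    (hT : IsOptimalMap (μ : Measure (Space d)) ν T) :
    ∫⁻ x, ‖x - T x‖ₑ ^ 2 ∂(μ : Measure (Space d)) = W2 (μ : Measure (Space d)) ν ^ 2 := by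
  obtain ⟨T', hT', hcost⟩ := exists_transportMap_lintegral_eq_W2_sq μ ν hμ
  exact le_antisymm ((hT.2 T' hT').trans hcost.le) (W2_sq_le_of_isTransportMap hT.1)

/-! ### Second moments -/

lemma lintegral_enorm_sq {α : Type*} [MeasurableSpace α] {ν : Measure α} {f : α → Space d}
    (hf : MemLp f 2 ν) : ∫⁻ x, ‖f x‖ₑ ^ 2 ∂ν = ENNReal.ofReal (∫ x, ‖f x‖ ^ 2 ∂ν) := by
  rw [ofReal_integral_eq_lintegral_ofReal ((memLp_two_iff_integrable_sq_norm hf.1).1 hf)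
    (Eventually.of_forall fun x => by positivity)]
  exact lintegral_congr fun x => by rw [ENNReal.ofReal_pow (norm_nonneg _), ofReal_norm]

lemma memLp_two_of_lintegral {α : Type*} [MeasurableSpace α] {ν : Measure α} {f : α → Space d}
    (hf : AEStronglyMeasurable f ν) (h : ∫⁻ x, ‖f x‖ₑ ^ 2 ∂ν < ∞) : MemLp f 2 ν := by
  rw [memLp_two_iff_integrable_sq_norm hf]
  refine ⟨hf.norm.pow 2, ?_⟩
  simpa [HasFiniteIntegral, enorm_pow] using h

lemma memLp_id (μ : P2 d) : MemLp (fun x => x) 2 (μ : Measure (Space d)) :=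
  memLp_two_of_lintegral measurable_id.aestronglyMeasurable μ.2.2

lemma memLp_of_map_eq {α : Type*} [MeasurableSpace α] {ν : Measure α} {f : α → Space d}
    (hf : Measurable f) {μ : P2 d} (h : ν.map f = μ) : MemLp f 2 ν := by
  refine (memLp_map_measure_iff (g := fun x => x) measurable_id.aestronglyMeasurable
    hf.aemeasurable).1 ?_
  rw [h]
  exact memLp_id μ

/-- The image, as an element of `P2`, of a probability measure under a square integrable map. -/
noncomputable def imageP2 {α : Type*} [MeasurableSpace α] (ν : Measure α) [IsProbabilityMeasure ν]
    (f : α → Space d) (hf : Measurable f) (hf2 : MemLp f 2 ν) : P2 d :=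
  ⟨ν.map f, Measure.isProbabilityMeasure_map hf.aemeasurable, by
    rw [lintegral_map (by fun_prop) hf, lintegral_enorm_sq hf2]
    exact ENNReal.ofReal_lt_top⟩

/-- The squared Wasserstein distance as a real number. -/
noncomputable def sqDist (μ ν : Measure (Space d)) : ℝ := (W2 μ ν ^ 2).toReal

lemma sqDist_nonneg (μ ν : Measure (Space d)) : 0 ≤ sqDist μ ν := ENNReal.toReal_nonneg

lemma ofReal_sqDist (μ ν : P2 d) :
    ENNReal.ofReal (sqDist (μ : Measure (Space d)) ν) = W2 (μ : Measure (Space d)) ν ^ 2 :=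
  ENNReal.ofReal_toReal (W2_sq_lt_top μ ν).ne

lemma sqDist_le_integral {α : Type*} [MeasurableSpace α] {ν : Measure α} {f g : α → Space d}
    (hf : Measurable f) (hg : Measurable g) (hf2 : MemLp f 2 ν) (hg2 : MemLp g 2 ν) :
    sqDist (ν.map f) (ν.map g) ≤ ∫ x, ‖f x - g x‖ ^ 2 ∂ν := by
  refine ENNReal.toReal_le_of_le_ofReal (integral_nonneg fun x => by positivity) ?_
  rw [← lintegral_enorm_sq (f := fun x => f x - g x) (hf2.sub hg2), ← planCost_map ν hf hg]
  exact W2_sq_le_planCost (map_prodMk_mem_plans ν hf hg)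

lemma IsOptimalMap.integral_eq {μ ν : P2 d} (hμ : IsAbs μ) {T : Space d → Space d}
    (hT : IsOptimalMap (μ : Measure (Space d)) ν T) :
    ∫ x, ‖x - T x‖ ^ 2 ∂(μ : Measure (Space d)) = sqDist (μ : Measure (Space d)) ν := by
  have h := hT.lintegral_eq hμ
  rw [lintegral_enorm_sq (f := fun x => x - T x)
    ((memLp_id μ).sub (memLp_of_map_eq hT.1.1 hT.1.2))] at h
  rw [sqDist, ← h, ENNReal.toReal_ofReal (integral_nonneg fun x => by positivity)]

/-! ### Convex functions of quadratic growth -/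

lemma continuous_of_convexOn_univ {f : Space d → ℝ} (hf : ConvexOn ℝ Set.univ f) :
    Continuous f :=
  continuousOn_univ.1 (hf.continuousOn isOpen_univ)

lemma QuadraticGrowth.integrable {α : Type*} [MeasurableSpace α] {ν : Measure α}
    [IsFiniteMeasure ν] {f : Space d → ℝ} (hf : QuadraticGrowth f) (hfc : Continuous f)
    {T : α → Space d} (hT : Measurable T) (hT2 : MemLp T 2 ν) :
    Integrable (fun x => f (T x)) ν := by
  obtain ⟨a, -, ha⟩ := hf
  refine ((hT2.integrable_norm_pow'.add (integrable_const 1)).const_mul a).mono'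
    (hfc.measurable.comp hT).aestronglyMeasurable (Eventually.of_forall fun x => ?_)
  simpa using ha (T x)

lemma potential_eq_integral {α : Type*} [MeasurableSpace α] {ν : Measure α} {f : Space d → ℝ}
    (hfc : Continuous f) {T : α → Space d} (hT : Measurable T) {μ : P2 d} (h : ν.map T = μ) :
    potential f μ = ∫ x, f (T x) ∂ν := by
  rw [potential, ← h, integral_map hT.aemeasurable hfc.aestronglyMeasurable]

/-- The subgradient inequality is tested at distance `r = ‖x‖ + 1` from `x` in the direction `v`.
The growth bounds contribute `5 a r²` and `2 a r²`, whence the factor 7. -/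
lemma QuadraticGrowth.norm_subgradient_le {H : Space d → ℝ} (hH : QuadraticGrowth H) :
    ∃ c : ℝ, 0 < c ∧ ∀ x, ∀ v ∈ subdifferential H x, ‖v‖ ≤ c * (‖x‖ + 1) := by
  obtain ⟨a, ha, hbd⟩ := hH
  refine ⟨7 * a, by positivity, fun x v hv => ?_⟩
  rcases eq_or_ne v 0 with rfl | hv0
  · rw [norm_zero]; positivity
  have hvn : 0 < ‖v‖ := norm_pos_iff.2 hv0
  set r := ‖x‖ + 1 with hr
  have hr1 : 1 ≤ r := by rw [hr]; linarith [norm_nonneg x]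
  have hrpos : 0 < r := by linarith
  have h1 := hv (x + (r / ‖v‖) • v)
  rw [add_sub_cancel_left, inner_smul_right, real_inner_self_eq_norm_sq] at h1
  have h2 : r / ‖v‖ * ‖v‖ ^ 2 = r * ‖v‖ := by field_simp
  rw [h2] at h1
  have h3 := (abs_le.1 (hbd x)).1
  have h4 := (abs_le.1 (hbd (x + (r / ‖v‖) • v))).2
  have h5 : ‖x + (r / ‖v‖) • v‖ ≤ 2 * r := by
    refine (norm_add_le _ _).trans ?_
    rw [norm_smul, Real.norm_of_nonneg (by positivity), div_mul_cancel₀ _ hvn.ne']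
    linarith
  have h6 : ‖x + (r / ‖v‖) • v‖ ^ 2 ≤ (2 * r) ^ 2 := by gcongr
  have h7 : ‖x‖ ^ 2 ≤ r ^ 2 := by gcongr; linarith
  have h8 : r * ‖v‖ ≤ r * (7 * a * r) := by
    have h9 : a * (‖x + (r / ‖v‖) • v‖ ^ 2 + 1) ≤ a * ((2 * r) ^ 2 + r ^ 2) := by
      gcongr
      nlinarith
    have h10 : a * (‖x‖ ^ 2 + 1) ≤ a * (r ^ 2 + r ^ 2) := by
      gcongr
      nlinarith
    nlinarith
  exact le_of_mul_le_mul_left h8 hrpos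

/-! ### The forward step -/

section Forward

variable {H : Space d → ℝ} {S : Space d → Space d} {η : ℝ}

lemma IsSubgradientSelector.inner_nonneg (hS : IsSubgradientSelector H S) (x y : Space d) :
    0 ≤ inner ℝ (S x - S y) (x - y) := by
  have h1 := hS x y
  have h2 := hS y x
  have h3 : inner ℝ (S x) (y - x) = -inner ℝ (S x) (x - y) := by
    rw [← inner_neg_right, neg_sub]
  rw [inner_sub_left]
  linarith

lemma IsSubgradientSelector.dist_le (hS : IsSubgradientSelector H S) (hη : 0 < η)
    (x y : Space d) : ‖x - y‖ ≤ ‖(x + η • S x) - (y + η • S y)‖ := by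
  have h1 : (x + η • S x) - (y + η • S y) = (x - y) + η • (S x - S y) := by
    rw [smul_sub]; abel
  refine le_of_sq_le_sq ?_ (norm_nonneg _)
  rw [h1, norm_add_sq_real, inner_smul_right, real_inner_comm]
  have h2 := mul_nonneg hη.le (hS.inner_nonneg x y)
  nlinarith [sq_nonneg ‖η • (S x - S y)‖]

/-- Monotonicity of `S` makes `I + η S` expanding, so its inverse is 1-Lipschitz on the range; a
Lipschitz extension makes it globally defined and Borel. -/
lemma IsSubgradientSelector.exists_leftInverse (hS : IsSubgradientSelector H S) (hη : 0 < η) :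
    ∃ (K : ℝ≥0) (g : Space d → Space d), LipschitzWith K g ∧ ∀ x, g (x + η • S x) = x := by
  set L : Space d → Space d := fun x => x + η • S x with hL
  have hinj : Function.Injective L := fun x y hxy => by
    have h := hS.dist_le hη x y
    change ‖x - y‖ ≤ ‖L x - L y‖ at h
    rw [hxy, sub_self, norm_zero] at h
    exact sub_eq_zero.1 (norm_le_zero_iff.1 h)
  have hlip : LipschitzOnWith 1 (Function.invFun L) (Set.range L) := by
    refine LipschitzOnWith.of_dist_le_mul ?_
    rintro _ ⟨x, rfl⟩ _ ⟨y, rfl⟩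
    rw [Function.leftInverse_invFun hinj x, Function.leftInverse_invFun hinj y, dist_eq_norm,
      dist_eq_norm, NNReal.coe_one, one_mul]
    exact hS.dist_le hη x y
  obtain ⟨g, hg, hgL⟩ := hlip.extend_finite_dimension
  exact ⟨_, g, hg, fun x =>
    (hgL (Set.mem_range_self x)).symm.trans (Function.leftInverse_invFun hinj x)⟩

/-- Lebesgue measure and `d`-dimensional Hausdorff measure have the same null sets, and Lipschitz
maps preserve those of the latter. -/
lemma volume_image_eq_zero {K : ℝ≥0} {g : Space d → Space d} (hg : LipschitzWith K g)
    {A : Set (Space d)} (hA : volume A = 0) : volume (g '' A) = 0 := by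
  have h1 : (volume : Measure (Space d)) ≪ μH[(Module.finrank ℝ (Space d) : ℝ)] :=
    Measure.absolutelyContinuous_isAddHaarMeasure _ _
  have h2 : μH[(Module.finrank ℝ (Space d) : ℝ)] ≪ (volume : Measure (Space d)) :=
    Measure.absolutelyContinuous_isAddHaarMeasure _ _
  refine h1 (le_antisymm ((hg.hausdorffMeasure_image_le (by positivity) A).trans ?_) bot_le)
  rw [h2 hA, mul_zero]

lemma memLp_subgradient (hH : QuadraticGrowth H) (hS : IsSubgradientSelector H S)
    (hSm : Measurable S) (μ : P2 d) : MemLp S 2 (μ : Measure (Space d)) := by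
  have := μ.2.1
  obtain ⟨c, hc, hbd⟩ := hH.norm_subgradient_le
  refine MemLp.of_le (g := fun x => c * (‖x‖ + 1))
    (((memLp_id μ).norm.add (memLp_const (1 : ℝ))).const_mul c) hSm.aestronglyMeasurable
    (Eventually.of_forall fun x => (hbd x _ (hS x)).trans (le_abs_self _))

lemma memLp_forwardMap (hH : QuadraticGrowth H) (hS : IsSubgradientSelector H S)
    (hSm : Measurable S) (μ : P2 d) :
    MemLp (fun x => x + η • S x) 2 (μ : Measure (Space d)) :=
  (memLp_id μ).add ((memLp_subgradient hH hS hSm μ).const_smul η)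

lemma exists_forward_eq (hH : QuadraticGrowth H) (hS : IsSubgradientSelector H S)
    (hSm : Measurable S) (μ : P2 d) :
    ∃ ν : P2 d, (ν : Measure (Space d)) = forward η S μ := by
  have := μ.2.1
  exact ⟨imageP2 (μ : Measure (Space d)) (fun x => x + η • S x) (by fun_prop)
    (memLp_forwardMap hH hS hSm μ), rfl⟩

lemma forward_absolutelyContinuous (hS : IsSubgradientSelector H S) (hSm : Measurable S)
    (hη : 0 < η) {μ : P2 d} (hμ : IsAbs μ) : forward η S μ ≪ volume := by
  obtain ⟨K, g, hg, hgL⟩ := hS.exists_leftInverse hη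
  refine Measure.AbsolutelyContinuous.mk fun A hA hA0 => ?_
  rw [forward, Measure.map_apply (by fun_prop) hA]
  have hsub : (fun x => x + η • S x) ⁻¹' A ⊆ g '' A := fun x hx => ⟨_, hx, hgL x⟩
  exact hμ (measure_mono_null hsub (volume_image_eq_zero hg hA0))

end Forward

/-! ### The backward step -/

lemma coe_W2_sq_div {η : ℝ} (hη : 0 < η) (μ ν : P2 d) :
    ((W2 (μ : Measure (Space d)) ν ^ 2 / ENNReal.ofReal (2 * η) : ℝ≥0∞) : EReal) =
      ((sqDist (μ : Measure (Space d)) ν / (2 * η) : ℝ) : EReal) := by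
  rw [← ofReal_sqDist, ← ENNReal.ofReal_div_of_pos (by positivity), EReal.coe_ennreal_ofReal,
    max_eq_left (div_nonneg (sqDist_nonneg _ _) (by positivity))]

section JKO

variable {G H : Space d → ℝ} {𝓗 : P2 d → EReal} {S : Space d → Space d} {η : ℝ}

lemma lt_top_of_mem_JKO (h𝓗 : IsProper 𝓗) (hη : 0 < η) {μ ρ : P2 d}
    (hρ : ρ ∈ JKO η (energy G 𝓗) (μ : Measure (Space d))) : 𝓗 ρ < ⊤ := by
  obtain ⟨σ, hσ⟩ := h𝓗.2
  have h := hρ σ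
  rw [coe_W2_sq_div hη, coe_W2_sq_div hη] at h
  lift 𝓗 σ to ℝ using ⟨hσ.ne, h𝓗.1 σ⟩ with s hs
  rw [lt_top_iff_ne_top]
  intro htop
  rw [energy, energy, htop, ← hs, EReal.coe_add_top, EReal.top_add_coe, ← EReal.coe_add,
    ← EReal.coe_add] at h
  exact EReal.coe_ne_top _ (top_le_iff.1 h)

lemma le_of_mem_JKO (h𝓗 : IsProper 𝓗) (hη : 0 < η) {μ ρ σ : P2 d}
    (hρ : ρ ∈ JKO η (energy G 𝓗) (μ : Measure (Space d))) (hσ : 𝓗 σ < ⊤) :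
    potential G ρ + (𝓗 ρ).toReal + sqDist (μ : Measure (Space d)) ρ / (2 * η) ≤
      potential G σ + (𝓗 σ).toReal + sqDist (μ : Measure (Space d)) σ / (2 * η) := by
  have h := hρ σ
  rw [coe_W2_sq_div hη, coe_W2_sq_div hη, energy, energy,
    ← EReal.coe_toReal (lt_top_of_mem_JKO h𝓗 hη hρ).ne (h𝓗.1 ρ),
    ← EReal.coe_toReal hσ.ne (h𝓗.1 σ)] at h
  exact_mod_cast h

/-- The minimizer in the JKO step is unique if the starting measure is absolutely continuous. -/
lemma BasicAssumptions.eq_of_mem_JKO {η₀ : ℝ} (hA : BasicAssumptions G H 𝓗 η₀) (hη : 0 < η)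
    {ν ρ ρ' : P2 d} (hν : IsAbs ν) (hρ : ρ ∈ JKO η (energy G 𝓗) (ν : Measure (Space d)))
    (hρ' : ρ' ∈ JKO η (energy G 𝓗) (ν : Measure (Space d))) : ρ = ρ' := by
  have := ν.2.1
  obtain ⟨T, hT⟩ := exists_isOptimalMap ν ρ hν
  obtain ⟨R, hR⟩ := exists_isOptimalMap ν ρ' hν
  have hTm := hT.1.1
  have hRm := hR.1.1
  have hT2 := memLp_of_map_eq hTm hT.1.2
  have hR2 := memLp_of_map_eq hRm hR.1.2
  -- Midpoint of the generalized geodesic with base `ν` joining the two minimizers.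
  set M : Space d → Space d := fun x => (1 / 2 : ℝ) • T x + (1 - 1 / 2 : ℝ) • R x with hM
  have hMm : Measurable M := by fun_prop
  have hM2 : MemLp M 2 (ν : Measure (Space d)) :=
    (hT2.const_smul (1 / 2 : ℝ)).add (hR2.const_smul (1 - 1 / 2 : ℝ))
  set σ : P2 d := imageP2 _ M hMm hM2 with hσ
  have hσM : (ν : Measure (Space d)).map M = σ := rfl
  have hfin := lt_top_of_mem_JKO hA.proper hη hρ
  have hfin' := lt_top_of_mem_JKO hA.proper hη hρ'
  have hconv := hA.convex ρ ρ' ν hν T R hT hR (1 / 2) (by norm_num) (by norm_num) σ rfl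
  rw [← EReal.coe_toReal hfin.ne (hA.proper.1 ρ), ← EReal.coe_toReal hfin'.ne (hA.proper.1 ρ'),
    ← EReal.coe_mul, ← EReal.coe_mul, ← EReal.coe_add] at hconv
  have hσfin : 𝓗 σ < ⊤ := hconv.trans_lt (EReal.coe_lt_top _)
  rw [← EReal.coe_toReal hσfin.ne (hA.proper.1 σ), EReal.coe_le_coe_iff] at hconv
  have hGc := continuous_of_convexOn_univ hA.convex_G
  have hGT := hA.growth_G.integrable hGc hTm hT2
  have hGR := hA.growth_G.integrable hGc hRm hR2
  have hpot : potential G σ ≤ 1 / 2 * potential G ρ + (1 - 1 / 2) * potential G ρ' := by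
    rw [potential_eq_integral hGc hMm hσM, potential_eq_integral hGc hTm hT.1.2,
      potential_eq_integral hGc hRm hR.1.2, ← integral_const_mul, ← integral_const_mul,
      ← integral_add (hGT.const_mul _) (hGR.const_mul _)]
    refine integral_mono (hA.growth_G.integrable hGc hMm hM2)
      ((hGT.const_mul _).add (hGR.const_mul _)) fun x => ?_
    exact hA.convex_G.2 (Set.mem_univ _) (Set.mem_univ _) (by norm_num) (by norm_num) (by norm_num)
  have hTi : Integrable (fun x => ‖x - T x‖ ^ 2) (ν : Measure (Space d)) :=
    MemLp.integrable_norm_pow' (p := 2) ((memLp_id ν).sub hT2)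
  have hRi : Integrable (fun x => ‖x - R x‖ ^ 2) (ν : Measure (Space d)) :=
    MemLp.integrable_norm_pow' (p := 2) ((memLp_id ν).sub hR2)
  have hTRi : Integrable (fun x => ‖T x - R x‖ ^ 2) (ν : Measure (Space d)) :=
    MemLp.integrable_norm_pow' (p := 2) (hT2.sub hR2)
  -- The parallelogram identity yields a quadratic gain at the midpoint; minimality of both
  -- endpoints forces it to vanish, so `T = R` almost everywhere.
  have hdist : sqDist (ν : Measure (Space d)) σ ≤
      1 / 2 * sqDist (ν : Measure (Space d)) ρ + 1 / 2 * sqDist (ν : Measure (Space d)) ρ' -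
        1 / 4 * ∫ x, ‖T x - R x‖ ^ 2 ∂(ν : Measure (Space d)) := by
    have h := sqDist_le_integral measurable_id hMm (memLp_id ν) hM2
    rw [Measure.map_id, hσM] at h
    refine h.trans (le_of_eq ?_)
    have hadd : Integrable (fun x => 1 / 2 * ‖x - T x‖ ^ 2 + 1 / 2 * ‖x - R x‖ ^ 2)
        (ν : Measure (Space d)) := (hTi.const_mul _).add (hRi.const_mul _)
    rw [← hT.integral_eq hν, ← hR.integral_eq hν, ← integral_const_mul, ← integral_const_mul,
      ← integral_const_mul, ← integral_add (hTi.const_mul _) (hRi.const_mul _),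
      ← integral_sub hadd (hTRi.const_mul _)]
    refine integral_congr_ae (Eventually.of_forall fun x => ?_)
    have h1 : x - M x = (1 / 2 : ℝ) • ((x - T x) + (x - R x)) := by
      simp only [hM]
      module
    have h2 : T x - R x = (x - R x) - (x - T x) := by abel
    simp only [id]
    rw [h1, h2, norm_smul, mul_pow, norm_add_sq_real, norm_sub_sq_real (x - R x), real_inner_comm,
      Real.norm_of_nonneg (by norm_num)]
    ring
  have h1 := le_of_mem_JKO hA.proper hη hρ hσfin
  have h2 := le_of_mem_JKO hA.proper hη hρ' hσfin
  have h3 := div_le_div_of_nonneg_right hdist (by positivity : (0 : ℝ) ≤ 2 * η)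
  rw [sub_div, add_div, mul_div_assoc, mul_div_assoc, mul_div_assoc] at h3
  have h4 : (∫ x, ‖T x - R x‖ ^ 2 ∂(ν : Measure (Space d))) / (2 * η) ≤ 0 := by linarith
  have h5 : ∫ x, ‖T x - R x‖ ^ 2 ∂(ν : Measure (Space d)) = 0 := by
    refine le_antisymm ?_ (integral_nonneg fun x => by positivity)
    by_contra! hpos
    exact absurd h4 (not_le.2 (div_pos hpos (by positivity)))
  rw [integral_eq_zero_iff_of_nonneg (fun x => by positivity) hTRi] at h5
  refine Subtype.ext ?_
  rw [← hT.1.2, ← hR.1.2]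
  refine Measure.map_congr (h5.mono fun x hx => ?_)
  simpa [sub_eq_zero] using hx

/-- One step of the scheme decreases the objective by at least `W2² / (2 η)`. -/
lemma BasicAssumptions.descent {η₀ : ℝ} (hA : BasicAssumptions G H 𝓗 η₀)
    (hS : IsSubgradientSelector H S) (hSm : Measurable S) (hη : 0 < η) {μ ρ : P2 d}
    (hμ : 𝓗 μ < ⊤) (hρ : ρ ∈ JKO η (energy G 𝓗) (forward η S μ)) :
    potential G ρ - potential H ρ + (𝓗 ρ).toReal + sqDist (μ : Measure (Space d)) ρ / (2 * η) ≤
      potential G μ - potential H μ + (𝓗 μ).toReal := by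
  have := μ.2.1
  obtain ⟨ν, hν⟩ := exists_forward_eq (η := η) hA.growth_H hS hSm μ
  have := ν.2.1
  have := ρ.2.1
  rw [← hν] at hρ
  have hjko := le_of_mem_JKO hA.proper hη hρ hμ
  have hS2 := memLp_subgradient hA.growth_H hS hSm μ
  have hHc := continuous_of_convexOn_univ hA.convex_H
  have hsqS : ∫ x, ‖η • S x‖ ^ 2 ∂(μ : Measure (Space d)) =
      η ^ 2 * ∫ x, ‖S x‖ ^ 2 ∂(μ : Measure (Space d)) := by
    rw [← integral_const_mul]
    refine integral_congr_ae (Eventually.of_forall fun x => ?_)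
    simp only [norm_smul, mul_pow, Real.norm_of_nonneg hη.le]
  have hup : sqDist (ν : Measure (Space d)) μ ≤
      η ^ 2 * ∫ x, ‖S x‖ ^ 2 ∂(μ : Measure (Space d)) := by
    have h := sqDist_le_integral (f := fun x => x + η • S x) (g := id) (by fun_prop) measurable_id
      (memLp_forwardMap hA.growth_H hS hSm μ) (memLp_id μ)
    rw [Measure.map_id] at h
    rw [hν, ← hsqS]
    simpa [forward] using h
  -- An optimal plan from `ν` to `ρ` is pulled back along the left inverse of the forward map; the
  -- resulting coupling of `μ` and `ρ` need not be optimal, but its cost bounds `W₂²(μ, ρ)` from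
  -- above.
  have hlow : sqDist (μ : Measure (Space d)) ρ + 2 * η * (potential H μ - potential H ρ) +
      η ^ 2 * ∫ x, ‖S x‖ ^ 2 ∂(μ : Measure (Space d)) ≤ sqDist (ν : Measure (Space d)) ρ := by
    obtain ⟨γ, hγ, hopt⟩ := exists_optimal_plan (ν : Measure (Space d)) ρ
    have hγprob := isProbabilityMeasure_of_mem_plans hγ
    obtain ⟨K, g, hg, hgL⟩ := hS.exists_leftInverse hη
    have hgm : Measurable g := hg.continuous.measurable
    set X : Space d × Space d → Space d := fun p => g p.1 with hX
    have hXm : Measurable X := by fun_prop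
    have hXμ : γ.map X = μ := by
      have : X = g ∘ Prod.fst := rfl
      rw [this, ← Measure.map_map hgm measurable_fst, hγ.1, hν, forward,
        Measure.map_map hgm (by fun_prop)]
      have h : g ∘ (fun x => x + η • S x) = id := funext hgL
      rw [h, Measure.map_id]
    have hae : ∀ᵐ p ∂γ, p.1 = X p + η • S (X p) := by
      refine ae_of_ae_map (f := Prod.fst) (p := fun z => z = g z + η • S (g z))
        measurable_fst.aemeasurable ?_
      have hset : MeasurableSet {z | z = g z + η • S (g z)} :=
        measurableSet_eq_fun measurable_id (by fun_prop)
      have hLm : Measurable fun x => x + η • S x := by fun_prop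
      rw [hγ.1, hν, forward, ae_map_iff hLm.aemeasurable hset]
      exact Eventually.of_forall fun x => by simp only [hgL]
    have hX2 : MemLp X 2 γ := memLp_of_map_eq hXm hXμ
    have hY2 : MemLp Prod.snd 2 γ := memLp_of_map_eq measurable_snd hγ.2
    have hZ2 : MemLp Prod.fst 2 γ := memLp_of_map_eq measurable_fst hγ.1
    have hSX2 : MemLp (fun p => S (X p)) 2 γ := by
      rw [← hXμ] at hS2
      exact (memLp_map_measure_iff hSm.aestronglyMeasurable hXm.aemeasurable).1 hS2
    have hcost : sqDist (ν : Measure (Space d)) ρ = ∫ p, ‖p.1 - p.2‖ ^ 2 ∂γ := by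
      have h : W2 (ν : Measure (Space d)) ρ ^ 2 = planCost γ := by
        rw [W2_sq]
        exact le_antisymm (iInf₂_le γ hγ) (le_iInf₂ hopt)
      rw [sqDist, h, planCost, lintegral_enorm_sq (f := fun p : Space d × Space d => p.1 - p.2)
          (hZ2.sub hY2),
        ENNReal.toReal_ofReal (integral_nonneg fun x => by positivity)]
    have hdist := sqDist_le_integral hXm measurable_snd hX2 hY2
    rw [hXμ, hγ.2] at hdist
    have hHX := hA.growth_H.integrable hHc hXm hX2
    have hHY := hA.growth_H.integrable hHc measurable_snd hY2
    have hXY : Integrable (fun p => ‖X p - p.2‖ ^ 2) γ :=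
      MemLp.integrable_norm_pow' (p := 2) (hX2.sub hY2)
    have hSX : Integrable (fun p => ‖S (X p)‖ ^ 2) γ := MemLp.integrable_norm_pow' (p := 2) hSX2
    have hZY : Integrable (fun p => ‖p.1 - p.2‖ ^ 2) γ :=
      MemLp.integrable_norm_pow' (p := 2) (hZ2.sub hY2)
    have hHXY : Integrable (fun p => 2 * η * (H (X p) - H p.2)) γ := (hHX.sub hHY).const_mul _
    have hadd : Integrable (fun p => ‖X p - p.2‖ ^ 2 + 2 * η * (H (X p) - H p.2)) γ :=
      hXY.add hHXY
    have hSμ : ∫ x, ‖S x‖ ^ 2 ∂(μ : Measure (Space d)) = ∫ p, ‖S (X p)‖ ^ 2 ∂γ := by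
      rw [← hXμ, integral_map hXm.aemeasurable (hSm.norm.pow_const 2).aestronglyMeasurable]
    calc sqDist (μ : Measure (Space d)) ρ + 2 * η * (potential H μ - potential H ρ) +
          η ^ 2 * ∫ x, ‖S x‖ ^ 2 ∂(μ : Measure (Space d))
        ≤ ∫ p, ‖X p - p.2‖ ^ 2 ∂γ + 2 * η * (potential H μ - potential H ρ) +
          η ^ 2 * ∫ x, ‖S x‖ ^ 2 ∂(μ : Measure (Space d)) := by gcongr
      _ = ∫ p, (‖X p - p.2‖ ^ 2 + 2 * η * (H (X p) - H p.2) + η ^ 2 * ‖S (X p)‖ ^ 2) ∂γ := by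
        rw [hSμ, potential_eq_integral hHc hXm hXμ,
          potential_eq_integral hHc measurable_snd hγ.2, ← integral_sub hHX hHY,
          ← integral_const_mul, ← integral_const_mul,
          ← integral_add hXY hHXY, ← integral_add hadd (hSX.const_mul _)]
      _ ≤ ∫ p, ‖p.1 - p.2‖ ^ 2 ∂γ := by
        refine integral_mono_ae (hadd.add (hSX.const_mul _)) hZY (hae.mono fun p hp => ?_)
        have h1 := hS (X p) p.2
        have h2 : p.1 - p.2 = (X p - p.2) + η • S (X p) := by
          conv_lhs => rw [hp]
          abel
        have h3 : inner ℝ (S (X p)) (p.2 - X p) = -inner ℝ (S (X p)) (X p - p.2) := by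
          rw [← inner_neg_right, neg_sub]
        rw [h3] at h1
        dsimp only
        rw [h2, norm_add_sq_real, norm_smul, mul_pow, Real.norm_of_nonneg hη.le, inner_smul_right,
          real_inner_comm]
        have h4 := mul_le_mul_of_nonneg_left h1 hη.le
        nlinarith
      _ = sqDist (ν : Measure (Space d)) ρ := hcost.symm
  have h1 := div_le_div_of_nonneg_right hlow (by positivity : (0 : ℝ) ≤ 2 * η)
  have h2 := div_le_div_of_nonneg_right hup (by positivity : (0 : ℝ) ≤ 2 * η)
  rw [add_div, add_div, mul_div_cancel_left₀ _ (by positivity : 2 * η ≠ 0)] at h1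
  linarith

lemma BasicAssumptions.exists_le {η₀ : ℝ} (hA : BasicAssumptions G H 𝓗 η₀) :
    ∃ c : ℝ, ∀ μ : P2 d, 𝓗 μ < ⊤ → c ≤ potential G μ - potential H μ + (𝓗 μ).toReal := by
  obtain ⟨c, hc⟩ := hA.bddBelow
  refine ⟨c, fun μ hμ => ?_⟩
  have := μ.2.1
  have h := hc μ
  rw [energy, ← EReal.coe_toReal hμ.ne (hA.proper.1 μ)] at h
  have h2 : potential (fun x => G x - H x) μ = potential G μ - potential H μ :=
    integral_sub
      (hA.growth_G.integrable (continuous_of_convexOn_univ hA.convex_G) measurable_id (memLp_id μ))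
      (hA.growth_H.integrable (continuous_of_convexOn_univ hA.convex_H) measurable_id (memLp_id μ))
  rw [h2] at h
  exact_mod_cast h

/-! ### The gradient mapping -/

lemma IsGradientMapping.memLp {μ : P2 d} {ξ : Space d → Space d}
    (hξ : IsGradientMapping G 𝓗 S η μ ξ) : MemLp ξ 2 (μ : Measure (Space d)) := by
  obtain ⟨ρ, -, T, hT, hξT⟩ := hξ
  rw [funext hξT]
  exact ((memLp_id μ).sub (memLp_of_map_eq hT.1.1 hT.1.2)).const_smul (1 / η)

lemma BasicAssumptions.exists_isGradientMapping {η₀ : ℝ} (hA : BasicAssumptions G H 𝓗 η₀)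
    (hS : IsSubgradientSelector H S) (hSm : Measurable S) (hη : 0 < η) (hη₀ : η < η₀) {μ : P2 d}
    (hμ : IsAbs μ) : ∃ ξ, IsGradientMapping G 𝓗 S η μ ξ := by
  obtain ⟨ν, hν⟩ := exists_forward_eq (η := η) hA.growth_H hS hSm μ
  obtain ⟨ρ, hρ⟩ := hA.jko_nonempty η hη hη₀ ν
  obtain ⟨T, hT⟩ := exists_isOptimalMap μ ρ hμ
  exact ⟨_, ρ, hν ▸ hρ, T, hT, fun x => rfl⟩

/-- By uniqueness of the JKO point, the `ρ'` inside `ξ` is the given `ρ`. With `ρ` the next iterate,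
the norm measures the step of the scheme. -/
lemma BasicAssumptions.eLpNorm_gradientMapping_sq {η₀ : ℝ} (hA : BasicAssumptions G H 𝓗 η₀)
    (hS : IsSubgradientSelector H S) (hSm : Measurable S) (hη : 0 < η) {μ ρ : P2 d}
    (hμ : IsAbs μ) (hρ : ρ ∈ JKO η (energy G 𝓗) (forward η S μ)) {ξ : Space d → Space d}
    (hξ : IsGradientMapping G 𝓗 S η μ ξ) :
    eLpNorm ξ 2 (μ : Measure (Space d)) ^ 2 =
      ENNReal.ofReal (sqDist (μ : Measure (Space d)) ρ / η ^ 2) := by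
  have hmem := hξ.memLp
  obtain ⟨ρ', hρ', T, hT, hξT⟩ := hξ
  obtain ⟨ν, hν⟩ := exists_forward_eq (η := η) hA.growth_H hS hSm μ
  have hνabs : IsAbs ν := by
    rw [IsAbs, hν]
    exact forward_absolutelyContinuous hS hSm hη hμ
  rw [← hν] at hρ hρ'
  obtain rfl := hA.eq_of_mem_JKO hη hνabs hρ hρ'
  have h1 : eLpNorm ξ 2 (μ : Measure (Space d)) ^ 2 =
      ∫⁻ x, ‖ξ x‖ₑ ^ 2 ∂(μ : Measure (Space d)) := by
    simpa using eLpNorm_nnreal_pow_eq_lintegral (μ := (μ : Measure (Space d))) (f := ξ)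
      (p := 2) two_ne_zero
  rw [h1, lintegral_enorm_sq hmem, ← hT.integral_eq hμ, ← integral_div]
  congr 1
  refine integral_congr_ae (Eventually.of_forall fun x => ?_)
  simp only [hξT, norm_smul, mul_pow, Real.norm_of_nonneg (one_div_pos.2 hη).le]
  ring

end JKO

end SemiFB

/-! ### Telescoping the descent inequality -/

theorem mainTheorem5 (d : ℕ) (G H : SemiFB.Space d → ℝ) (𝓗 : SemiFB.P2 d → EReal) (η₀ : ℝ)
    (hA : SemiFB.BasicAssumptions G H 𝓗 η₀)
    (S : SemiFB.Space d → SemiFB.Space d)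
    (hS : SemiFB.IsSubgradientSelector H S) (hSm : Measurable S)
    (η : ℝ) (hη : 0 < η) (hη₀ : η < η₀)
    (m : ℕ → SemiFB.P2 d) (hm₀ : SemiFB.IsAbs (m 0))
    (hm : SemiFB.IsSemiFBEuler G 𝓗 S η m) :
    (∀ n, ∃ ξ, SemiFB.IsGradientMapping G 𝓗 S η (m n) ξ) ∧
    (∀ n ξ, SemiFB.IsGradientMapping G 𝓗 S η (m n) ξ →
      MemLp ξ 2 (m n : Measure (SemiFB.Space d))) ∧
    ∃ C : ℝ, ∀ ξ : ℕ → SemiFB.Space d → SemiFB.Space d,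
      (∀ n, SemiFB.IsGradientMapping G 𝓗 S η (m n) (ξ n)) →
        ∀ N : ℕ, 1 ≤ N →
          (⨅ n ∈ Finset.Icc 1 N, eLpNorm (ξ n) 2 (m n : Measure (SemiFB.Space d)) ^ 2) ≤
            ENNReal.ofReal (C / N) := by
  -- `𝓗 (m 0)` may be infinite; every later iterate has finite energy, so the sum starts at `F 1`.
  have hfin : ∀ n, 𝓗 (m (n + 1)) < ⊤ := fun n => by
    obtain ⟨ν, hν⟩ := SemiFB.exists_forward_eq (η := η) hA.growth_H hS hSm (m n)
    exact SemiFB.lt_top_of_mem_JKO hA.proper hη (hν ▸ hm n)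
  have habs : ∀ n, SemiFB.IsAbs (m n) := fun n => by
    cases n with
    | zero => exact hm₀
    | succ n => exact hA.dom_abs _ (hfin n)
  refine ⟨fun n => hA.exists_isGradientMapping hS hSm hη hη₀ (habs n), fun n ξ hξ => hξ.memLp, ?_⟩
  obtain ⟨c, hc⟩ := hA.exists_le
  set F : ℕ → ℝ := fun n =>
    SemiFB.potential G (m n) - SemiFB.potential H (m n) + (𝓗 (m n)).toReal with hF
  -- The factor `2 / η` converts `W₂² / (2η)`, the drop in `F`, into `W₂² / η²`, the squared norm.
  refine ⟨2 / η * (F 1 - c), fun ξ hξ N hN => ?_⟩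
  set w : ℕ → ℝ := fun n =>
    SemiFB.sqDist (m n : Measure (SemiFB.Space d)) (m (n + 1)) / η ^ 2 with hw
  have hstep : ∀ n ∈ Finset.Icc 1 N, w n ≤ 2 / η * (F n - F (n + 1)) := fun n hn => by
    obtain ⟨k, rfl⟩ := Nat.exists_eq_add_of_le' (Finset.mem_Icc.1 hn).1
    have h := hA.descent hS hSm hη (hfin k) (hm (k + 1))
    have h1 : SemiFB.sqDist (m (k + 1) : Measure (SemiFB.Space d)) (m (k + 1 + 1)) / (2 * η) ≤
        F (k + 1) - F (k + 1 + 1) := by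
      simp only [hF]
      linarith
    calc w (k + 1) = 2 / η *
          (SemiFB.sqDist (m (k + 1) : Measure (SemiFB.Space d)) (m (k + 1 + 1)) / (2 * η)) := by
          simp only [hw]
          field_simp
      _ ≤ _ := by gcongr
  have hsum : ∑ n ∈ Finset.Icc 1 N, w n ≤ 2 / η * (F 1 - c) := by
    calc ∑ n ∈ Finset.Icc 1 N, w n ≤ ∑ n ∈ Finset.Icc 1 N, 2 / η * (F n - F (n + 1)) :=
          Finset.sum_le_sum hstep
      _ = 2 / η * (F 1 - F (N + 1)) := by
          rw [← Finset.mul_sum, ← Finset.Ico_add_one_right_eq_Icc,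
            ← neg_sub (F (N + 1)), ← Finset.sum_Ico_sub F (by omega : 1 ≤ N + 1),
            ← Finset.sum_neg_distrib]
          simp only [neg_sub]
      _ ≤ 2 / η * (F 1 - c) := by
          gcongr
          exact hc _ (hfin N)
  have hN0 : (0 : ℝ) < N := by exact_mod_cast hN
  -- Some term is at most the average.
  obtain ⟨n, hn, hle⟩ : ∃ n ∈ Finset.Icc 1 N, w n ≤ 2 / η * (F 1 - c) / N := by
    refine Finset.exists_le_of_sum_le ⟨1, Finset.mem_Icc.2 ⟨le_rfl, hN⟩⟩ (hsum.trans ?_)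
    rw [Finset.sum_const, Nat.card_Icc, nsmul_eq_mul, Nat.add_sub_cancel,
      mul_div_cancel₀ _ hN0.ne']
  refine (iInf₂_le n hn).trans ?_
  rw [hA.eLpNorm_gradientMapping_sq hS hSm hη (habs n) (hm n) (hξ n)]
  exact ENNReal.ofReal_le_ofReal hle
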